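/- For $n\in\mathbb{N}=\{0,1,2,\dots\}$ let $A_n=\sum_{k=0}^{n}\binom{n}{k}^2\binom{n+k}{k}^2$ be the $n$-th Apéry number. (i) For every positive integer $n$, the number $$\frac{1}{n(n+1)}\sum_{k=1}^{n}(-1)^{n-k}(9k^2+10k+3)k^2A_k$$ is a positive odd integer. (ii) For every odd prime $p$, $$\sum_{k=1}^{p}(-1)^{k}(9k^2+10k+3)k^2A_k\equiv \frac{p}{3}\cdot\left(\frac{p}{3}\right)_{\!L}-15p^2\pmod{p^3},$$ where $\frac p3$ is the ordinary fraction and $\left(\frac{p}{3}\right)_{\!L}$ is the Legendre symbol of $p$ modulo $3$ (equal to $0$ for $p=3$). Here two rational numbers $a,b$ are called congruent modulo $p^3$ if $a-b=p^3c$ for some rational number $c$ whose reduced denominator is not divisible by $p$. -/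

import Mathlib

/-- The Apéry number `A_n = ∑_{k=0}^n C(n,k)^2 C(n+k,k)^2`. -/
def aperyNumber (n : ℕ) : ℕ :=
  ∑ k ∈ Finset.range (n + 1), n.choose k ^ 2 * (n + k).choose k ^ 2

/-- Congruence of rational numbers modulo a positive integer `m`: the difference `a - b` is `m`
times a rational number whose reduced denominator is coprime to `m`. For `m = p ^ r` with `p` prime
and `r` positive, this says that `a - b` lies in `p ^ r` times the ring of rational `p`-adic
integers. -/
def RatModEq (m : ℕ) (a b : ℚ) : Prop :=
  ∃ c : ℚ, c.den.Coprime m ∧ a - b = m * c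

/-!
Write `d(n,k) = C(n,k) C(n+k,k)`, so that `A_n = ∑ d(n,k)²`. As a polynomial in `n`, `d(n,k)` is
`∏_{i<k} (n(n+1) - i(i+1)) / k!²`.

By Apéry's recurrence, `(-1)^k ((9k²+10k+3)k² - (2k+1)/3) A_k` telescopes:
`72 ∑_{k≤n} (-1)^k (9k²+10k+3)k² A_k` equals `24 ∑_{k≤n} (-1)^k (2k+1) A_k` plus a
boundary term divisible by `(n+1)³`. The remaining sum is evaluated by linearizing `d(n,j)²` in the
`d(n,m)`, which gives Strehl's identity `A_n = ∑ f_m d(n,m)` with the Franel numbers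
`f_m = ∑ C(m,j)³`, and by `∑_{k≤n} (-1)^k (2k+1) d(k,m) = (-1)^n (n+1) C(n,m) C(n+1+m,m)`. Hence
it is `(-1)^n (n+1) Q_n` with the integer `Q_n = ∑ f_m C(n,m) C(n+1+m,m)` (`franelSum`).

For the first part, this closed form, written once for the sum up to `n` and once for the sum up to
`n+1`, shows that `n` and `n+1` divide `72` times the sum. The factor `72` is removed with
`f_m ≡ 2^m` modulo `6`, which yields that `Q_n` is odd and that `Q_n ≡ ±(n+1)` modulo `3`, and with
`A_n ≡ 1` modulo `4`; the same computation modulo `16` shows that the quotient is odd. Positivity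
holds because the terms increase in absolute value.

For the second part, the closed form with `n+1 = p` reduces the claim to `A_p ≡ 5` modulo `p` and
`Q_{p-1} ≡ (p/3)` modulo `p²`. Since `C(p-1,m) C(p+m,m) ≡ (-1)^m` modulo `p²`, the number `Q_{p-1}`
is congruent to `∑_{m<p} (-1)^m f_m`, which is congruent to `∑_{j<p} C(2j,j)` by MacMahon's formula
`f_m = ∑ C(m,j)² C(2j,m)` and the value of Legendre polynomials at `-1`. Finally
`∑_{j<n} C(2j,j) = ∑_k (k/3) C(2n,n-k)`, and for `n = p` this is `(p/3)` modulo `p²` because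
`C(2p,i) ≡ 2 C(p,i)` and `∑_k (k/3) C(p,k) = (p/3)`. The prime `3`, which divides `72`, is
checked by evaluation.
-/

/-! ### The products `C(n,k) C(n+k,k)` -/

/-- The product `C(n,k) C(n+k,k)`, as an integer; its square is the `k`-th summand of `A_n`.
As a function of `n` it is a polynomial in `n (n + 1)`, hence invariant under `n ↦ -1 - n`. -/
def chooseProd (n k : ℕ) : ℤ := n.choose k * (n + k).choose k

theorem chooseProd_zero_right (n : ℕ) : chooseProd n 0 = 1 := by simp [chooseProd]

theorem chooseProd_eq_zero {n k : ℕ} (h : n < k) : chooseProd n k = 0 := by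
  simp [chooseProd, Nat.choose_eq_zero_of_lt h]

theorem cast_choose_succ_right (n k : ℕ) :
    (n.choose (k + 1) : ℤ) * (k + 1) = n.choose k * (n - k) := by
  have h := Nat.choose_succ_right_eq n k
  rcases le_or_gt k n with hk | hk
  · have := congrArg (Nat.cast : ℕ → ℤ) h
    push_cast [Nat.cast_sub hk] at this
    exact this
  · simp [Nat.choose_eq_zero_of_lt hk, Nat.choose_eq_zero_of_lt (hk.trans (Nat.lt_succ_self k))]

theorem cast_choose_succ_succ (n k : ℕ) :
    ((n + 1).choose (k + 1) : ℤ) * (k + 1) = (n + 1) * n.choose k := by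
  exact_mod_cast (Nat.add_one_mul_choose_eq n k).symm

theorem cast_choose_succ_left (n k : ℕ) :
    ((n + 1).choose k : ℤ) * (n + 1 - k) = (n + 1) * n.choose k := by
  have h := cast_choose_succ_right (n + 1) k
  have h' := cast_choose_succ_succ n k
  push_cast at h
  linarith

theorem cast_choose_add_succ_left (n k : ℕ) :
    ((n + 1 + k).choose k : ℤ) * (n + 1) = (n + k + 1) * (n + k).choose k := by
  have h := cast_choose_succ_left (n + k) k
  rw [show n + 1 + k = n + k + 1 by ring]
  push_cast at h
  linarith

theorem sq_mul_chooseProd_succ (n k : ℕ) :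
    ((k : ℤ) + 1) ^ 2 * chooseProd n (k + 1) = (n - k) * (n + k + 1) * chooseProd n k := by
  have h1 := cast_choose_succ_right n k
  have h2 := cast_choose_succ_succ (n + k) k
  unfold chooseProd
  rw [← add_assoc]
  push_cast at h2
  linear_combination ((n + k + 1).choose (k + 1) : ℤ) * (k + 1) * h1 +
    (n.choose k : ℤ) * (n - k) * h2

theorem sq_mul_chooseProd_succ_succ (n k : ℕ) :
    ((k : ℤ) + 1) ^ 2 * chooseProd (n + 1) (k + 1) =
      (n + k + 2) * (n + k + 1) * chooseProd n k := by
  have h1 := cast_choose_succ_succ n k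
  have h2 := cast_choose_succ_succ (n + 1 + k) k
  have h3 := cast_choose_add_succ_left n k
  unfold chooseProd
  rw [← add_assoc]
  push_cast at h2
  linear_combination ((n + 1 + k + 1).choose (k + 1) : ℤ) * (k + 1) * h1 +
    (n + 1) * (n.choose k : ℤ) * h2 + (n.choose k : ℤ) * (n + k + 2) * h3

theorem sq_mul_chooseProd_succ_of_succ_left (n k : ℕ) :
    ((k : ℤ) + 1) ^ 2 * chooseProd n (k + 1) = (n + 1 - k) * (n - k) * chooseProd (n + 1) k := by
  have h1 := cast_choose_succ_right n k
  have h2 := cast_choose_succ_left n k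
  have h3 := cast_choose_succ_succ (n + k) k
  have h4 := cast_choose_add_succ_left n k
  unfold chooseProd
  rw [← add_assoc]
  push_cast at h3
  linear_combination ((n + k + 1).choose (k + 1) : ℤ) * (k + 1) * h1 +
    (n.choose k : ℤ) * (n - k) * h3 - (n.choose k : ℤ) * (n - k) * h4 -
    (n - k) * ((n + 1 + k).choose k : ℤ) * h2

/-! ### Apéry's recurrence -/

theorem aperyNumber_eq_sum_range {n N : ℕ} (h : n < N) :
    (aperyNumber n : ℤ) = ∑ k ∈ Finset.range N, chooseProd n k ^ 2 := by
  rw [aperyNumber]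
  push_cast
  simp_rw [← mul_pow]
  refine Finset.sum_subset (Finset.range_mono h) fun k _ hk => ?_
  have : n < k := by simpa [Nat.lt_succ_iff] using hk
  simp [Nat.choose_eq_zero_of_lt this]

/-- Zeilberger's telescoping certificate for the Apéry recurrence. -/
theorem sum_range_apery_recurrence (n K : ℕ) :
    ∑ k ∈ Finset.range (K + 1), (((n : ℤ) + 2) ^ 3 * chooseProd (n + 2) k ^ 2 -
      (2 * n + 3) * (17 * (n + 1) ^ 2 + 17 * (n + 1) + 5) * chooseProd (n + 1) k ^ 2 +
      (n + 1) ^ 3 * chooseProd n k ^ 2) =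
    4 * (2 * n + 3) * (K * (2 * K + 1) - (2 * n + 3) ^ 2) * chooseProd (n + 1) K ^ 2 := by
  induction K with
  | zero => simp [chooseProd_zero_right]; ring
  | succ K ih =>
    rw [Finset.sum_range_succ, ih]
    have h1 := sq_mul_chooseProd_succ_succ (n + 1) K
    have h2 := sq_mul_chooseProd_succ (n + 1) K
    have h3 := sq_mul_chooseProd_succ_of_succ_left n K
    have hK : ((K : ℤ) + 1) ^ 4 ≠ 0 := by positivity
    refine mul_left_cancel₀ hK ?_
    push_cast at h1 h2 h3 ⊢
    have e1 := congrArg (· ^ 2) h1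
    have e2 := congrArg (· ^ 2) h2
    have e3 := congrArg (· ^ 2) h3
    linear_combination ((n : ℤ) + 2) ^ 3 * e1 -
      ((2 * n + 3) * (17 * (n + 1) ^ 2 + 17 * (n + 1) + 5) +
        4 * (2 * n + 3) * ((K + 1) * (2 * (K + 1) + 1) - (2 * n + 3) ^ 2)) * e2 +
      ((n : ℤ) + 1) ^ 3 * e3

/-- Apéry's recurrence. -/
theorem aperyNumber_recurrence (n : ℕ) :
    ((n : ℤ) + 2) ^ 3 * aperyNumber (n + 2) =
      (2 * n + 3) * (17 * (n + 1) ^ 2 + 17 * (n + 1) + 5) * aperyNumber (n + 1) -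
        (n + 1) ^ 3 * aperyNumber n := by
  have h := sum_range_apery_recurrence n (n + 2)
  rw [Finset.sum_add_distrib, Finset.sum_sub_distrib, ← Finset.mul_sum, ← Finset.mul_sum,
    ← Finset.mul_sum, ← aperyNumber_eq_sum_range (by lia), ← aperyNumber_eq_sum_range (by lia),
    ← aperyNumber_eq_sum_range (by lia), chooseProd_eq_zero (by lia)] at h
  linarith

/-! ### Franel numbers and Strehl's identity -/

/-- Linearization of products of the polynomials `n ↦ C(n,k) C(n+k,k)`. -/
theorem chooseProd_mul_chooseProd (n i j : ℕ) :
    chooseProd n i * chooseProd n j = ∑ m ∈ Finset.range (i + j + 1),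
      (m.choose i * m.choose j * (i + j).choose m : ℤ) * chooseProd n m := by
  induction i with
  | zero =>
    rw [Finset.sum_eq_single j]
    · simp [chooseProd_zero_right]
    · intro m hm hne
      have : m < j := by simp at hm; lia
      simp [Nat.choose_eq_zero_of_lt this]
    · simp
  | succ i ih =>
    have hi : ((i : ℤ) + 1) ^ 2 ≠ 0 := by positivity
    refine mul_left_cancel₀ hi ?_
    rw [← mul_assoc, sq_mul_chooseProd_succ, mul_assoc, ih, Finset.mul_sum, Finset.mul_sum,
      show i + 1 + j + 1 = (i + j + 1) + 1 by ring, Finset.sum_range_succ' _ (i + j + 1)]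
    -- The factor `n (n + 1) - i (i + 1)` acts on the `m`-th polynomial by raising `m`.
    have step : ∀ m : ℕ, ((n : ℤ) - i) * (n + i + 1) *
        ((m.choose i * m.choose j * (i + j).choose m : ℤ) * chooseProd n m) =
        (m.choose i * m.choose j * (i + j).choose m : ℤ) * (m + 1) ^ 2 * chooseProd n (m + 1) +
        (m.choose i * m.choose j * (i + j).choose m : ℤ) * (m * (m + 1) - i * (i + 1)) *
          chooseProd n m := by
      intro m
      linear_combination (-(m.choose i * m.choose j * (i + j).choose m : ℤ)) *
        sq_mul_chooseProd_succ n m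
    rw [Finset.sum_congr rfl fun m _ => step m, Finset.sum_add_distrib]
    have hext : ∑ m ∈ Finset.range (i + j + 1),
        (m.choose i * m.choose j * (i + j).choose m : ℤ) * (m * (m + 1) - i * (i + 1)) *
          chooseProd n m = ∑ m ∈ Finset.range (i + j + 1),
        ((m + 1).choose i * (m + 1).choose j * (i + j).choose (m + 1) : ℤ) *
          ((m + 1) * (m + 2) - i * (i + 1)) * chooseProd n (m + 1) := by
      have h0 : ((0 : ℕ).choose i : ℤ) * (i * (i + 1)) = 0 := by
        cases i <;> simp
      have hlast := Finset.sum_range_succ (fun m : ℕ =>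
        (m.choose i * m.choose j * (i + j).choose m : ℤ) * (m * (m + 1) - i * (i + 1)) *
          chooseProd n m) (i + j + 1)
      rw [Nat.choose_eq_zero_of_lt (Nat.lt_succ_self (i + j)), Finset.sum_range_succ'] at hlast
      push_cast at hlast
      have hz : ((0 : ℕ).choose i * (0 : ℕ).choose j * (i + j).choose 0 : ℤ) *
          (0 - i * (i + 1)) * chooseProd n 0 = 0 := by
        linear_combination (-((0 : ℕ).choose j * (i + j).choose 0 : ℤ) * chooseProd n 0) * h0
      rw [hz] at hlast
      simp only [mul_zero, zero_mul, add_zero] at hlast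
      rw [← hlast]
      exact Finset.sum_congr rfl fun m _ => by ring
    rw [hext, ← Finset.sum_add_distrib]
    simp only [Nat.choose_zero_succ, Nat.cast_zero, zero_mul, mul_zero, add_zero]
    refine Finset.sum_congr rfl fun m _ => ?_
    have h1 := cast_choose_succ_right (m + 1) i
    have h2 := cast_choose_succ_left m i
    have h3 := cast_choose_succ_left m j
    have h4 := cast_choose_succ_right (i + j) m
    rw [show i + 1 + j = i + j + 1 by ring, Nat.choose_succ_succ (i + j) m]
    push_cast at h1 h2 h3 h4 ⊢
    linear_combination (-(i + 1) * ((m + 1).choose j : ℤ) *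
        ((i + j).choose m + (i + j).choose (m + 1)) * chooseProd n (m + 1)) * h1
      - ((m + 1) * (m.choose j : ℤ) * (i + j).choose m * chooseProd n (m + 1)) * h2
      - (((m + 1).choose i : ℤ) * (m + 1 - i) * (i + j).choose m * chooseProd n (m + 1)) * h3
      + (((m + 1).choose i : ℤ) * (m + 1 - i) * (m + 1).choose j * chooseProd n (m + 1)) * h4

/-- The Franel numbers. -/
def franel (m : ℕ) : ℤ := ∑ j ∈ Finset.range (m + 1), (m.choose j : ℤ) ^ 3

theorem sum_range_choose_mul_choose {m i : ℕ} (hi : i ≤ m) :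
    ∑ t ∈ Finset.range (m + 1), (m - i).choose t * i.choose t = m.choose i := by
  have h := Nat.add_choose_eq (m - i) i i
  rw [Nat.sub_add_cancel hi, Finset.Nat.sum_antidiagonal_eq_sum_range_succ_mk] at h
  rw [h]
  symm
  refine Finset.sum_subset_zero_on_sdiff (Finset.range_mono (by lia)) (fun t ht => ?_)
    fun t ht => ?_
  · simp only [Finset.mem_sdiff, Finset.mem_range] at ht
    simp [Nat.choose_eq_zero_of_lt (show i < t by lia)]
  · have : t ≤ i := by simpa [Nat.lt_succ_iff] using ht
    rw [Nat.choose_symm this]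

/-- MacMahon's form of the Franel numbers. -/
theorem franel_eq_sum (m : ℕ) :
    franel m = ∑ j ∈ Finset.range (m + 1), (m.choose j : ℤ) ^ 2 * (2 * j).choose m := by
  have key : ∀ j ∈ Finset.range (m + 1), m.choose j ^ 2 * (2 * j).choose m =
      ∑ i ∈ Finset.range (m + 1),
        m.choose i ^ 2 * ((m - i).choose (m - j) * i.choose (m - j)) := by
    intro j hj
    have hj : j ≤ m := by simpa [Nat.lt_succ_iff] using hj
    rw [two_mul, Nat.add_choose_eq, Finset.Nat.sum_antidiagonal_eq_sum_range_succ_mk,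
      Finset.mul_sum]
    refine Finset.sum_congr rfl fun i hi => ?_
    have hi : i ≤ m := by simpa [Nat.lt_succ_iff] using hi
    rcases lt_or_ge j i with h | h
    · simp [Nat.choose_eq_zero_of_lt h, Nat.choose_eq_zero_of_lt (show m - i < m - j by lia)]
    rcases lt_or_ge j (m - i) with h' | h'
    · simp [Nat.choose_eq_zero_of_lt h', Nat.choose_eq_zero_of_lt (show i < m - j by lia)]
    have e1 := Nat.choose_mul (n := m) h
    have e2 := Nat.choose_mul (n := m) h'
    rw [Nat.choose_symm hi, show m - (m - i) = i by lia,
      ← Nat.choose_symm (show j - (m - i) ≤ i by lia),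
      show i - (j - (m - i)) = m - j by lia] at e2
    rw [← Nat.choose_symm (show j - i ≤ m - i by lia),
      show m - i - (j - i) = m - j by lia] at e1
    calc m.choose j ^ 2 * (j.choose i * j.choose (m - i))
        = (m.choose j * j.choose i) * (m.choose j * j.choose (m - i)) := by ring
      _ = _ := by rw [e1, e2]; ring
  have hnat : ∑ j ∈ Finset.range (m + 1), m.choose j ^ 2 * (2 * j).choose m =
      ∑ i ∈ Finset.range (m + 1), m.choose i ^ 3 := by
    rw [Finset.sum_congr rfl key, Finset.sum_comm]
    refine Finset.sum_congr rfl fun i hi => ?_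
    have hi : i ≤ m := by simpa [Nat.lt_succ_iff] using hi
    rw [← Finset.mul_sum, ← Finset.sum_range_reflect, pow_succ]
    congr 1
    rw [← sum_range_choose_mul_choose hi]
    refine Finset.sum_congr rfl fun t ht => ?_
    have ht : t ≤ m := by simpa [Nat.lt_succ_iff] using ht
    rw [show m - (m + 1 - 1 - t) = t by lia]
  rw [franel]
  exact_mod_cast hnat.symm

/-- Strehl's identity: the Apéry numbers are the Legendre transform of the Franel numbers. -/
theorem aperyNumber_eq_sum_franel {n N : ℕ} (h : n < N) :
    (aperyNumber n : ℤ) = ∑ m ∈ Finset.range N, franel m * chooseProd n m := by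
  rw [aperyNumber_eq_sum_range h]
  have hsq : ∀ j ∈ Finset.range N, chooseProd n j ^ 2 = ∑ m ∈ Finset.range (2 * N),
      ((m.choose j : ℤ) ^ 2 * (2 * j).choose m) * chooseProd n m := by
    intro j hj
    have hj := Finset.mem_range.1 hj
    rw [sq, chooseProd_mul_chooseProd]
    simp_rw [sq, two_mul]
    refine Finset.sum_subset (Finset.range_mono (by lia)) fun m _ hm => ?_
    have : j + j < m := by simp at hm; lia
    simp [Nat.choose_eq_zero_of_lt this]
  rw [Finset.sum_congr rfl hsq, Finset.sum_comm]
  symm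
  refine Finset.sum_subset_zero_on_sdiff (Finset.range_mono (by lia)) (fun m hm => ?_)
    fun m hm => ?_
  · simp only [Finset.mem_sdiff, Finset.mem_range] at hm
    simp [chooseProd_eq_zero (show n < m by lia)]
  · rw [← Finset.sum_mul, franel_eq_sum]
    congr 1
    have hm := Finset.mem_range.1 hm
    refine Finset.sum_subset (Finset.range_mono (by lia)) fun j _ hj => ?_
    have : m < j := by simp at hj; lia
    simp [Nat.choose_eq_zero_of_lt this]

/-! ### The alternating sum of `(2k+1) A_k` -/

/-- The product `C(n,m) C(n+1+m,m)`, through which the alternating sums over `k ≤ n` of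
`(2k+1) C(k,m) C(k+m,m)` are expressed. -/
def chooseProdShift (n m : ℕ) : ℤ := n.choose m * (n + 1 + m).choose m

theorem chooseProdShift_eq_zero {n m : ℕ} (h : n < m) : chooseProdShift n m = 0 := by
  simp [chooseProdShift, Nat.choose_eq_zero_of_lt h]

theorem succ_mul_chooseProdShift (n m : ℕ) :
    ((n : ℤ) + 1) * chooseProdShift n m = (n + 1 + m) * chooseProd n m := by
  have h := cast_choose_add_succ_left n m
  unfold chooseProdShift chooseProd
  linear_combination (n.choose m : ℤ) * h

theorem succ_mul_chooseProdShift' (n m : ℕ) :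
    ((n : ℤ) + 1) * chooseProdShift n m = (n + 1 - m) * chooseProd (n + 1) m := by
  have h := cast_choose_succ_left n m
  unfold chooseProdShift chooseProd
  linear_combination -((n + 1 + m).choose m : ℤ) * h

theorem sum_range_neg_one_pow_mul_chooseProd (n m : ℕ) :
    ∑ k ∈ Finset.range (n + 1), (-1 : ℤ) ^ k * (2 * k + 1) * chooseProd k m =
      (-1) ^ n * (n + 1) * chooseProdShift n m := by
  induction n with
  | zero => cases m <;> simp [chooseProdShift, chooseProd]
  | succ n ih =>
    rw [Finset.sum_range_succ, ih]
    have h1 := succ_mul_chooseProdShift (n + 1) m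
    have h2 := succ_mul_chooseProdShift' n m
    push_cast at h1 ⊢
    rw [pow_succ]
    linear_combination (-1 : ℤ) ^ n * h1 + (-1) ^ n * h2

/-- The quotient of `∑_{k ≤ n} (-1)^k (2k+1) A_k` by `(-1)^n (n+1)`, in terms of the Franel
numbers. -/
def franelSum (n : ℕ) : ℤ := ∑ m ∈ Finset.range (n + 1), franel m * chooseProdShift n m

theorem sum_range_neg_one_pow_mul_aperyNumber (n : ℕ) :
    ∑ k ∈ Finset.range (n + 1), (-1 : ℤ) ^ k * (2 * k + 1) * aperyNumber k =
      (-1) ^ n * (n + 1) * franelSum n := by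
  have h : ∀ k ∈ Finset.range (n + 1), (-1 : ℤ) ^ k * (2 * k + 1) * aperyNumber k =
      ∑ m ∈ Finset.range (n + 1), franel m * ((-1 : ℤ) ^ k * (2 * k + 1) * chooseProd k m) := by
    intro k hk
    rw [aperyNumber_eq_sum_franel (Finset.mem_range.1 hk), Finset.mul_sum]
    exact Finset.sum_congr rfl fun m _ => by ring
  rw [Finset.sum_congr rfl h, Finset.sum_comm, franelSum, Finset.mul_sum]
  refine Finset.sum_congr rfl fun m _ => ?_
  rw [← Finset.mul_sum, sum_range_neg_one_pow_mul_chooseProd]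
  ring

theorem chooseProd_succ_add_chooseProd (n m : ℕ) :
    chooseProd (n + 1) m + chooseProd n m = 2 * ((n + 1).choose m * (n + m).choose m) := by
  have h1 := cast_choose_add_succ_left n m
  have h2 := cast_choose_succ_left n m
  have hn : (n : ℤ) + 1 ≠ 0 := by positivity
  refine mul_left_cancel₀ hn ?_
  unfold chooseProd
  linear_combination ((n + 1).choose m : ℤ) * h1 - ((n + m).choose m : ℤ) * h2

/-- The alternating sum is Gosper summable, with the partial sums on the right; it vanishes for
`K = n + 1`. -/
theorem sum_range_neg_one_pow_mul_choose (n K : ℕ) :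
    ∑ m ∈ Finset.range (K + 1), (-1 : ℤ) ^ m * ((n + 1).choose m * (n + m).choose m) =
      (-1) ^ K * chooseProdShift n K := by
  induction K with
  | zero => simp [chooseProdShift]
  | succ K ih =>
    rw [Finset.sum_range_succ, ih, chooseProdShift, chooseProdShift]
    have h1 := cast_choose_succ_succ n K
    have h2 := cast_choose_succ_right (n + K + 1) K
    have e1 : (((n + 1).choose (K + 1) : ℕ) : ℤ) = n.choose K + n.choose (K + 1) := by
      rw [Nat.choose_succ_succ]; push_cast; ring
    have e2 : (((n + K + 2).choose (K + 1) : ℕ) : ℤ) =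
        (n + K + 1).choose K + (n + K + 1).choose (K + 1) := by
      rw [Nat.choose_succ_succ]; push_cast; ring
    have e3 : ((n + 1).choose (K + 1) : ℤ) * (n + K + 1).choose K =
        n.choose K * (n + K + 1).choose (K + 1) := by
      have hK : (K : ℤ) + 1 ≠ 0 := by positivity
      refine mul_left_cancel₀ hK ?_
      push_cast at h2
      linear_combination ((n + K + 1).choose K : ℤ) * h1 - (n.choose K : ℤ) * h2
    rw [show n + 1 + K = n + K + 1 by ring, show n + 1 + (K + 1) = n + K + 2 by ring,
      ← add_assoc n K 1, e2, pow_succ]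
    rw [e1] at e3 ⊢
    linear_combination (-1 : ℤ) ^ K * e3

/-- The value at `-1` of the `n`-th Legendre polynomial. -/
theorem sum_range_neg_one_pow_mul_chooseProd_right {n N : ℕ} (h : n < N) :
    ∑ i ∈ Finset.range N, (-1 : ℤ) ^ i * chooseProd n i = (-1) ^ n := by
  have hN : ∀ {n N : ℕ}, n < N → ∑ i ∈ Finset.range N, (-1 : ℤ) ^ i * chooseProd n i =
      ∑ i ∈ Finset.range (n + 1), (-1 : ℤ) ^ i * chooseProd n i := by
    intro n N h
    symm
    refine Finset.sum_subset (Finset.range_mono h) fun i _ hi => ?_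
    rw [chooseProd_eq_zero (by simp at hi; lia), mul_zero]
  rw [hN h]
  clear h N
  induction n with
  | zero => simp [chooseProd]
  | succ n ih =>
    have h := sum_range_neg_one_pow_mul_choose n (n + 1)
    rw [chooseProdShift_eq_zero (Nat.lt_succ_self n), mul_zero] at h
    rw [← hN (show n < n + 1 + 1 by lia)] at ih
    rw [pow_succ, mul_neg_one, ← ih, ← add_eq_zero_iff_eq_neg, ← Finset.sum_add_distrib,
      ← mul_zero 2, ← h, Finset.mul_sum]
    refine Finset.sum_congr rfl fun i _ => ?_
    linear_combination (-1 : ℤ) ^ i * chooseProd_succ_add_chooseProd n i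

/-- Obtained by summing the value at `-1` of the `k`-th Legendre polynomial, with weight
`(-1)^k (2k+1)`, over `k ≤ n`. -/
theorem sum_range_neg_one_pow_mul_chooseProdShift (n : ℕ) :
    ∑ m ∈ Finset.range (n + 1), (-1 : ℤ) ^ m * chooseProdShift n m = (-1) ^ n * (n + 1) := by
  have hsum : ∑ k ∈ Finset.range (n + 1), (2 * (k : ℤ) + 1) = (n + 1) ^ 2 := by
    induction n with
    | zero => simp
    | succ n ih => rw [Finset.sum_range_succ, ih]; push_cast; ring
  have hn : (-1 : ℤ) ^ n * (n + 1) ≠ 0 := by positivity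
  have hsq : ∀ k : ℕ, (-1 : ℤ) ^ k * (-1) ^ k = 1 := fun k => by rw [← mul_pow]; simp
  refine mul_left_cancel₀ hn ?_
  calc (-1 : ℤ) ^ n * (n + 1) * ∑ m ∈ Finset.range (n + 1), (-1 : ℤ) ^ m * chooseProdShift n m
      = ∑ m ∈ Finset.range (n + 1), ∑ k ∈ Finset.range (n + 1),
          (-1 : ℤ) ^ k * (2 * k + 1) * ((-1) ^ m * chooseProd k m) := by
        rw [Finset.mul_sum]
        refine Finset.sum_congr rfl fun m _ => ?_
        rw [mul_left_comm, ← sum_range_neg_one_pow_mul_chooseProd, Finset.mul_sum]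
        exact Finset.sum_congr rfl fun k _ => by ring
    _ = ∑ k ∈ Finset.range (n + 1), (2 * (k : ℤ) + 1) := by
        rw [Finset.sum_comm]
        refine Finset.sum_congr rfl fun k hk => ?_
        rw [← Finset.mul_sum, sum_range_neg_one_pow_mul_chooseProd_right (Finset.mem_range.1 hk)]
        linear_combination (2 * (k : ℤ) + 1) * hsq k
    _ = (-1 : ℤ) ^ n * (n + 1) * ((-1) ^ n * (n + 1)) := by
        rw [hsum]
        linear_combination -((n : ℤ) + 1) ^ 2 * hsq n

/-! ### The weighted sum in closed form -/

theorem neg_one_pow_mul_self (n : ℕ) : (-1 : ℤ) ^ n * (-1) ^ n = 1 := by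
  rw [← mul_pow, neg_one_mul, neg_neg, one_pow]

/-- The sum of the theorem, without the sign `(-1)^n`; the term `k = 0` vanishes. -/
def weightedAperySum (n : ℕ) : ℤ :=
  ∑ k ∈ Finset.range (n + 1),
    (-1) ^ k * (9 * (k : ℤ) ^ 2 + 10 * k + 3) * (k : ℤ) ^ 2 * aperyNumber k

theorem weightedAperySum_succ (n : ℕ) : weightedAperySum (n + 1) = weightedAperySum n +
    (-1) ^ (n + 1) * (9 * ((n : ℤ) + 1) ^ 2 + 10 * (n + 1) + 3) * ((n : ℤ) + 1) ^ 2 *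
      aperyNumber (n + 1) := by
  rw [weightedAperySum, Finset.sum_range_succ]
  push_cast
  rfl

/-- Closed form of the sum, exhibiting the factor `n + 1`. -/
theorem weightedAperySum_eq (n : ℕ) : 72 * ((-1) ^ n * weightedAperySum n) =
    ((n : ℤ) + 1) * (24 * franelSum n + (n + 1) ^ 2 *
      ((18 * n + 11) * aperyNumber n + (18 * n - 7) * aperyNumber (n + 1))) := by
  have h : 72 * weightedAperySum n =
      24 * ∑ k ∈ Finset.range (n + 1), (-1 : ℤ) ^ k * (2 * k + 1) * aperyNumber k +
        (-1) ^ n * (n + 1) ^ 3 *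
          ((18 * n + 11) * aperyNumber n + (18 * n - 7) * aperyNumber (n + 1)) := by
    induction n with
    | zero => simp [weightedAperySum, aperyNumber, Finset.sum_range_succ]
    | succ n ih =>
      rw [weightedAperySum_succ, Finset.sum_range_succ, mul_add, ih, pow_succ]
      have hr := aperyNumber_recurrence n
      push_cast
      linear_combination (-1 : ℤ) ^ n * (18 * (n : ℤ) + 11) * hr
  rw [sum_range_neg_one_pow_mul_aperyNumber] at h
  linear_combination (-1 : ℤ) ^ n * h + ((n : ℤ) + 1) * (24 * franelSum n + (n + 1) ^ 2 *
      ((18 * n + 11) * aperyNumber n + (18 * n - 7) * aperyNumber (n + 1))) *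
    neg_one_pow_mul_self n

/-- Closed form of the sum, for upper limit `n + 1`, also exhibiting the factor `n + 1`. -/
theorem weightedAperySum_succ_eq (n : ℕ) : 72 * ((-1) ^ n * weightedAperySum (n + 1)) =
    ((n : ℤ) + 1) * (24 * franelSum n - 216 * (n + 1) * aperyNumber (n + 1) -
      (n + 1) ^ 2 * ((630 * (n + 1) + 745) * aperyNumber (n + 1) -
        (18 * (n + 1) - 7) * aperyNumber n)) := by
  rw [weightedAperySum_succ, pow_succ]
  linear_combination weightedAperySum_eq n - 72 * (9 * ((n : ℤ) + 1) ^ 2 + 10 * (n + 1) + 3) *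
    ((n : ℤ) + 1) ^ 2 * aperyNumber (n + 1) * neg_one_pow_mul_self n

/-! ### Divisibility and parity -/

/-- Every integer is congruent to its cube modulo `6`. -/
theorem franel_modEq_six (m : ℕ) : franel m ≡ 2 ^ m [ZMOD 6] := by
  have h2 : (2 : ℤ) ^ m = ∑ j ∈ Finset.range (m + 1), (m.choose j : ℤ) := by
    exact_mod_cast (Nat.sum_range_choose m).symm
  have h3 : ∀ x : ZMod 6, x ^ 3 = x := by decide
  refine (ZMod.intCast_eq_intCast_iff _ _ 6).1 ?_
  rw [h2, franel]
  push_cast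
  exact Finset.sum_congr rfl fun j _ => h3 _

theorem two_dvd_franel_succ (m : ℕ) : 2 ∣ franel (m + 1) := by
  have h := (franel_modEq_six (m + 1)).of_dvd (show (2 : ℤ) ∣ 6 by norm_num)
  exact h.dvd_iff.2 (dvd_pow_self 2 (Nat.succ_ne_zero m))

theorem franel_zero : franel 0 = 1 := by simp [franel]

theorem two_dvd_chooseProd_succ (n m : ℕ) : 2 ∣ chooseProd n (m + 1) := by
  have h := Nat.choose_mul (n := n + (m + 1)) (k := 2 * (m + 1)) (s := m + 1) (by lia)
  rw [show n + (m + 1) - (m + 1) = n by lia, show 2 * (m + 1) - (m + 1) = m + 1 by lia] at h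
  have hd : 2 ∣ (n + (m + 1)).choose (m + 1) * n.choose (m + 1) :=
    h ▸ Dvd.dvd.mul_left (Nat.two_dvd_centralBinom_succ m) _
  rw [chooseProd, mul_comm]
  exact_mod_cast hd

theorem aperyNumber_modEq_four (n : ℕ) : (aperyNumber n : ℤ) ≡ 1 [ZMOD 4] := by
  rw [aperyNumber_eq_sum_franel (Nat.lt_succ_self n), Finset.sum_range_succ', franel_zero,
    chooseProd_zero_right]
  refine ((Int.modEq_zero_iff_dvd.2 (Finset.dvd_sum fun m _ => ?_)).add_right _)
  exact mul_dvd_mul (two_dvd_franel_succ m) (two_dvd_chooseProd_succ n m)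

theorem franelSum_modEq_two (n : ℕ) : franelSum n ≡ 1 [ZMOD 2] := by
  rw [franelSum, Finset.sum_range_succ', franel_zero]
  have h0 : chooseProdShift n 0 = 1 := by simp [chooseProdShift]
  rw [h0]
  exact (Int.modEq_zero_iff_dvd.2 (Finset.dvd_sum fun m _ =>
    (two_dvd_franel_succ m).mul_right _)).add_right _

theorem franelSum_modEq_three (n : ℕ) : franelSum n ≡ (-1) ^ n * (n + 1) [ZMOD 3] := by
  rw [← sum_range_neg_one_pow_mul_chooseProdShift, franelSum]
  refine Int.ModEq.sum fun m _ => Int.ModEq.mul_right _ ?_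
  exact ((franel_modEq_six m).of_dvd (by norm_num)).trans
    (Int.ModEq.pow m (show (2 : ℤ) ≡ -1 [ZMOD 3] by decide))

/-- Removal of the factor `72` from a divisibility by `N`. -/
theorem exists_eq_mul_of_seventyTwo_mul {N T X : ℤ} (hN : N ≠ 0) (h : 72 * T = N * X)
    (h2 : 2 ∣ N → ∃ w, X = 8 + 16 * w) (h3 : 3 ∣ N → 9 ∣ X) :
    ∃ Y, T = N * Y ∧ (2 ∣ N → Odd Y) := by
  obtain ⟨X', hX', hodd⟩ : ∃ X', 9 * T = N * X' ∧ (2 ∣ N → Odd X') := by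
    by_cases hN2 : 2 ∣ N
    · obtain ⟨w, rfl⟩ := h2 hN2
      exact ⟨1 + 2 * w, by linarith, fun _ => ⟨w, by ring⟩⟩
    · have hc : IsCoprime N (2 ^ 3) :=
        ((Int.prime_two.coprime_iff_not_dvd.2 hN2).symm).pow_right
      obtain ⟨X', hX'⟩ := hc.dvd_of_dvd_mul_left (show N ∣ 2 ^ 3 * (9 * T) from ⟨X, by linarith⟩)
      exact ⟨X', hX', fun h => absurd h hN2⟩
  have hXX : X = 8 * X' := mul_left_cancel₀ hN (by linarith)
  obtain ⟨Y, hY⟩ : ∃ Y, T = N * Y := by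
    by_cases hN3 : 3 ∣ N
    · have : 9 ∣ X' := by have := h3 hN3; lia
      obtain ⟨Y, rfl⟩ := this
      exact ⟨Y, by linarith⟩
    · have hc : IsCoprime N (3 ^ 2) :=
        ((Int.prime_three.coprime_iff_not_dvd.2 hN3).symm).pow_right
      exact hc.dvd_of_dvd_mul_left (show N ∣ 3 ^ 2 * T from ⟨X', by linarith⟩)
  refine ⟨Y, hY, fun hN2 => ?_⟩
  have hYX : X' = 9 * Y := mul_left_cancel₀ hN (by rw [← hX', hY]; ring)
  exact (Int.odd_mul.1 (hYX ▸ hodd hN2)).2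

/-- The factor `n + 1` divides the sum up to `n`, with odd quotient if it is even. -/
theorem exists_weightedAperySum_eq_mul (n : ℕ) :
    ∃ Y, weightedAperySum n = ((n : ℤ) + 1) * Y ∧ (2 ∣ (n : ℤ) + 1 → Odd Y) := by
  obtain ⟨a, ha⟩ := (aperyNumber_modEq_four n).symm.dvd
  obtain ⟨b, hb⟩ := (aperyNumber_modEq_four (n + 1)).symm.dvd
  obtain ⟨q, hq⟩ := (franelSum_modEq_two n).symm.dvd
  obtain ⟨Y, hY, hodd⟩ := exists_eq_mul_of_seventyTwo_mul (T := (-1) ^ n * weightedAperySum n)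
    (N := (n : ℤ) + 1) (by positivity)
    (weightedAperySum_eq n)
    (by
      rintro ⟨u, hu⟩
      refine ⟨1 + 3 * q + u ^ 2 * (18 * u - 8 + (36 * u - 7) * a + (36 * u - 25) * b), ?_⟩
      rw [eq_add_of_sub_eq ha, eq_add_of_sub_eq hb, eq_add_of_sub_eq hq, eq_sub_of_add_eq hu]
      ring)
    (by
      rintro ⟨u, hu⟩
      have hQ : 3 ∣ franelSum n := (franelSum_modEq_three n).dvd_iff.2
        (Dvd.dvd.mul_left ⟨u, hu⟩ _)
      obtain ⟨r, hr⟩ := hQ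
      refine ⟨8 * r + u ^ 2 * ((18 * n + 11) * aperyNumber n +
        (18 * n - 7) * aperyNumber (n + 1)), ?_⟩
      rw [hr, hu]
      ring)
  refine ⟨(-1) ^ n * Y, ?_, fun h => Int.odd_mul.2 ⟨Odd.pow (by decide), hodd h⟩⟩
  linear_combination (-1 : ℤ) ^ n * hY - weightedAperySum n * neg_one_pow_mul_self n

/-- The factor `n + 1` divides the sum up to `n + 1`, with odd quotient if it is even. -/
theorem exists_weightedAperySum_succ_eq_mul (n : ℕ) :
    ∃ Y, weightedAperySum (n + 1) = ((n : ℤ) + 1) * Y ∧ (2 ∣ (n : ℤ) + 1 → Odd Y) := by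
  obtain ⟨a, ha⟩ := (aperyNumber_modEq_four n).symm.dvd
  obtain ⟨b, hb⟩ := (aperyNumber_modEq_four (n + 1)).symm.dvd
  obtain ⟨q, hq⟩ := (franelSum_modEq_two n).symm.dvd
  obtain ⟨Y, hY, hodd⟩ := exists_eq_mul_of_seventyTwo_mul
    (T := (-1) ^ n * weightedAperySum (n + 1)) (N := (n : ℤ) + 1) (by positivity)
    (weightedAperySum_succ_eq n)
    (by
      rintro ⟨u, hu⟩
      refine ⟨1 + 3 * q - 27 * u * aperyNumber (n + 1) -
        u ^ 2 * (188 + 306 * u + (1260 * u + 745) * b + (7 - 36 * u) * a), ?_⟩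
      rw [hu, eq_add_of_sub_eq ha, eq_add_of_sub_eq hb, eq_add_of_sub_eq hq]
      ring)
    (by
      rintro ⟨u, hu⟩
      have hQ : 3 ∣ franelSum n := (franelSum_modEq_three n).dvd_iff.2
        (Dvd.dvd.mul_left ⟨u, hu⟩ _)
      obtain ⟨r, hr⟩ := hQ
      refine ⟨8 * r - 72 * u * aperyNumber (n + 1) -
        u ^ 2 * ((630 * (n + 1) + 745) * aperyNumber (n + 1) -
          (18 * (n + 1) - 7) * aperyNumber n), ?_⟩
      rw [hr, hu]
      ring)
  refine ⟨(-1) ^ n * Y, ?_, fun h => Int.odd_mul.2 ⟨Odd.pow (by decide), hodd h⟩⟩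
  linear_combination (-1 : ℤ) ^ n * hY - weightedAperySum (n + 1) * neg_one_pow_mul_self n

theorem exists_odd_weightedAperySum_eq {n : ℕ} (hn : 0 < n) :
    ∃ Y, weightedAperySum n = (n : ℤ) * (n + 1) * Y ∧ Odd Y := by
  obtain ⟨Y₁, h₁, hodd₁⟩ := exists_weightedAperySum_eq_mul n
  obtain ⟨Y₂, h₂, hodd₂⟩ : ∃ Y, weightedAperySum n = (n : ℤ) * Y ∧ (2 ∣ (n : ℤ) → Odd Y) := by
    obtain ⟨m, rfl⟩ := Nat.exists_eq_succ_of_ne_zero hn.ne'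
    simpa using exists_weightedAperySum_succ_eq_mul m
  have hc : IsCoprime (n : ℤ) (n + 1) := ⟨-1, 1, by ring⟩
  obtain ⟨Y, hY⟩ := hc.mul_dvd ⟨Y₂, h₂⟩ ⟨Y₁, h₁⟩
  have hn0 : (n : ℤ) ≠ 0 := by exact_mod_cast hn.ne'
  have hn1 : (n : ℤ) + 1 ≠ 0 := by positivity
  have e₁ : Y₁ = n * Y := mul_left_cancel₀ hn1 (by rw [← h₁, hY]; ring)
  have e₂ : Y₂ = (n + 1) * Y := mul_left_cancel₀ hn0 (by rw [← h₂, hY]; ring)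
  refine ⟨Y, hY, ?_⟩
  rcases Int.even_or_odd (n : ℤ) with h | h
  · exact (Int.odd_mul.1 (e₂ ▸ hodd₂ h.two_dvd)).2
  · exact (Int.odd_mul.1 (e₁ ▸ hodd₁ (h.add_one.two_dvd))).2

/-! ### Positivity -/

theorem aperyNumber_mono : Monotone aperyNumber := by
  refine monotone_nat_of_le_succ fun n => ?_
  refine Finset.sum_le_sum_of_subset_of_nonneg (Finset.range_mono (by lia)) ?_ |>.trans'
    (Finset.sum_le_sum fun k _ => ?_)
  · exact fun _ _ _ => Nat.zero_le _
  · gcongr <;> lia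

/-- An alternating sum with strictly increasing terms has the sign of its last term. -/
theorem neg_one_pow_mul_weightedAperySum_pos {n : ℕ} (hn : 0 < n) :
    0 < (-1) ^ n * weightedAperySum n := by
  have key : ∀ n : ℕ, (0 ≤ (-1) ^ n * weightedAperySum n ∧ (-1) ^ n * weightedAperySum n ≤
      (9 * (n : ℤ) ^ 2 + 10 * n + 3) * (n : ℤ) ^ 2 * aperyNumber n) ∧
      0 < (-1) ^ (n + 1) * weightedAperySum (n + 1) := by
    have step : ∀ n : ℕ, (-1) ^ (n + 1) * weightedAperySum (n + 1) =
        (9 * ((n : ℤ) + 1) ^ 2 + 10 * (n + 1) + 3) * ((n : ℤ) + 1) ^ 2 * aperyNumber (n + 1) -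
          (-1) ^ n * weightedAperySum n := by
      intro n
      rw [weightedAperySum_succ, mul_add]
      linear_combination (9 * ((n : ℤ) + 1) ^ 2 + 10 * (n + 1) + 3) * ((n : ℤ) + 1) ^ 2 *
        aperyNumber (n + 1) * neg_one_pow_mul_self (n + 1)
    have hlt : ∀ n : ℕ, (9 * (n : ℤ) ^ 2 + 10 * n + 3) * (n : ℤ) ^ 2 * aperyNumber n <
        (9 * ((n : ℤ) + 1) ^ 2 + 10 * (n + 1) + 3) * ((n : ℤ) + 1) ^ 2 *
          aperyNumber (n + 1) := by
      intro n
      have hA : (aperyNumber n : ℤ) ≤ aperyNumber (n + 1) := by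
        exact_mod_cast aperyNumber_mono (Nat.le_succ n)
      have hpos : (0 : ℤ) < aperyNumber (n + 1) := by
        have h0 : aperyNumber 0 = 1 := by simp [aperyNumber]
        have := aperyNumber_mono (Nat.zero_le (n + 1))
        exact_mod_cast (show 0 < aperyNumber (n + 1) by lia)
      have hn : (0 : ℤ) ≤ n := Int.natCast_nonneg n
      calc (9 * (n : ℤ) ^ 2 + 10 * n + 3) * (n : ℤ) ^ 2 * aperyNumber n
          ≤ (9 * (n : ℤ) ^ 2 + 10 * n + 3) * (n : ℤ) ^ 2 * aperyNumber (n + 1) := by gcongr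
        _ < _ := by
          refine mul_lt_mul_of_pos_right ?_ hpos
          have : (n : ℤ) < n + 1 := by lia
          gcongr
    intro n
    induction n with
    | zero => simp [weightedAperySum, aperyNumber, Finset.sum_range_succ]
    | succ n ih =>
      have h1 := step n
      have h2 := step (n + 1)
      have h3 := hlt (n + 1)
      push_cast at h2 h3 ⊢
      refine ⟨⟨ih.2.le, ?_⟩, ?_⟩ <;> linarith [ih.1.1, ih.1.2]
  obtain ⟨m, rfl⟩ := Nat.exists_eq_succ_of_ne_zero hn.ne'
  exact (key m).2

theorem cast_weightedAperySum (n : ℕ) : (weightedAperySum n : ℚ) =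
    ∑ k ∈ Finset.Icc 1 n, (-1 : ℚ) ^ k * (9 * (k : ℚ) ^ 2 + 10 * (k : ℚ) + 3) * (k : ℚ) ^ 2 *
      (aperyNumber k : ℚ) := by
  rw [weightedAperySum, Finset.range_eq_Ico, Finset.sum_eq_sum_Ico_succ_bot (Nat.succ_pos n)]
  push_cast
  simp
  rfl

/-! ### Central binomial coefficients modulo `p²` -/

theorem legendreSym_three_natCast (k : ℕ) :
    legendreSym 3 (k : ℤ) = if k % 3 = 0 then 0 else if k % 3 = 1 then 1 else -1 := by
  rw [legendreSym.mod]
  have h : k % 3 = 0 ∨ k % 3 = 1 ∨ k % 3 = 2 := by lia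
  have hc : (k : ℤ) % (3 : ℕ) = ((k % 3 : ℕ) : ℤ) := by push_cast; rfl
  rw [hc]
  rcases h with h | h | h <;> rw [h] <;> decide

theorem legendreSym_three_add (k : ℕ) : legendreSym 3 (k : ℤ) + legendreSym 3 ((k + 1 : ℕ) : ℤ) +
    legendreSym 3 ((k + 2 : ℕ) : ℤ) = 0 := by
  simp only [legendreSym_three_natCast]
  split_ifs <;> lia

theorem legendreSym_three_two_mul (k : ℕ) :
    legendreSym 3 ((2 * k : ℕ) : ℤ) = -legendreSym 3 (k : ℤ) := by
  simp only [legendreSym_three_natCast]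
  split_ifs <;> lia

/-- Evaluation of `∑ χ(i) C(n,i)` for the quadratic character `χ` modulo `3`, with a shift that
makes an induction by Pascal's rule possible. -/
theorem sum_legendreSym_three_mul_choose (n r : ℕ) :
    ∑ i ∈ Finset.range (n + 1), legendreSym 3 ((i + r : ℕ) : ℤ) * n.choose i =
      (-1) ^ n * legendreSym 3 ((2 * n + r : ℕ) : ℤ) := by
  induction n generalizing r with
  | zero => simp
  | succ n ih =>
    have h1 := ih r
    have h2 := ih (r + 1)
    have h3 := legendreSym_three_add (2 * n + r)
    have h4 : ∑ i ∈ Finset.range (n + 1 + 1), legendreSym 3 ((i + r : ℕ) : ℤ) * n.choose i =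
        ∑ i ∈ Finset.range (n + 1), legendreSym 3 ((i + r : ℕ) : ℤ) * n.choose i := by
      rw [Finset.sum_range_succ]; simp
    rw [Finset.sum_range_succ'] at h4 ⊢
    simp_rw [Nat.choose_succ_succ n, Nat.cast_add (n.choose _), mul_add]
    rw [Finset.sum_add_distrib, show 2 * n + 2 * 1 + r = 2 * n + r + 2 by ring, pow_succ]
    simp only [Nat.choose_zero_right, zero_add, Nat.cast_one, mul_one] at h4 ⊢
    simp only [show ∀ i : ℕ, i + 1 + r = i + (r + 1) by intro i; ring] at h4 ⊢
    rw [show 2 * n + (r + 1) = 2 * n + r + 1 by ring] at h2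
    linear_combination h2 + h4 + h1 + (-1 : ℤ) ^ n * h3

open PowerSeries in
/-- The generating function `x / (1 + x + x²)` of the quadratic character modulo `3`. -/
theorem one_add_X_add_X_sq_mul_mk_legendreSym :
    (1 + X + X ^ 2 : ℤ⟦X⟧) * mk (fun k : ℕ => legendreSym 3 (k : ℤ)) = X := by
  ext n
  rw [add_mul, add_mul, one_mul, map_add, map_add, pow_two, mul_assoc]
  rcases n with _ | _ | n
  · simp
  · simp [coeff_succ_X_mul, coeff_one_X]
  · have h := legendreSym_three_add n
    rw [coeff_succ_X_mul, coeff_succ_X_mul, coeff_succ_X_mul, coeff_X, if_neg (by lia)]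
    simp only [coeff_mk]
    rw [← h]
    ring

open PowerSeries in
theorem coeff_one_add_X_pow_int (n k : ℕ) : coeff k ((1 + X : ℤ⟦X⟧) ^ n) = n.choose k := by
  have h := Polynomial.coeff_one_add_X_pow ℤ n k
  rw [← Polynomial.coeff_coe] at h
  simpa using h

open PowerSeries in
/-- Both sides are the coefficient of `x^n` in `(1 + x)^{2n} x / (1 + x + x²)`. -/
theorem sum_centralBinom_eq (n : ℕ) : ∑ j ∈ Finset.range n, ((2 * j).choose j : ℤ) =
    ∑ k ∈ Finset.range (n + 1), legendreSym 3 (k : ℤ) * (2 * n).choose (n - k) := by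
  have h : ∑ j ∈ Finset.range n, ((2 * j).choose j : ℤ) =
      coeff n (mk (fun k : ℕ => legendreSym 3 (k : ℤ)) * (1 + X : ℤ⟦X⟧) ^ (2 * n)) := by
    induction n with
    | zero => simp
    | succ n ih =>
      have e : mk (fun k : ℕ => legendreSym 3 (k : ℤ)) * (1 + X : ℤ⟦X⟧) ^ (2 * (n + 1)) =
          X * (1 + X) ^ (2 * n) +
            X * (mk (fun k : ℕ => legendreSym 3 (k : ℤ)) * (1 + X) ^ (2 * n)) := by
        rw [mul_add, pow_add]
        linear_combination (1 + X : ℤ⟦X⟧) ^ (2 * n) * one_add_X_add_X_sq_mul_mk_legendreSym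
      rw [Finset.sum_range_succ, ih, e, map_add, coeff_succ_X_mul, coeff_succ_X_mul,
        coeff_one_add_X_pow_int, add_comm]
  rw [h, coeff_mul, Finset.Nat.sum_antidiagonal_eq_sum_range_succ_mk]
  exact Finset.sum_congr rfl fun k _ => by rw [coeff_mk, coeff_one_add_X_pow_int]

theorem choose_two_mul_prime_modEq {p i : ℕ} (hp : p.Prime) (hi : 0 < i) (hip : i ≤ p) :
    ((2 * p).choose i : ℤ) ≡ 2 * p.choose i [ZMOD (p : ℤ) ^ 2] := by
  obtain ⟨i, rfl⟩ := Nat.exists_eq_succ_of_ne_zero hi.ne'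
  have hd : ∀ k, k < i → (p : ℤ) ∣ (p.choose (k + 1) : ℤ) := fun k hk => by
    exact_mod_cast hp.dvd_choose_self (Nat.succ_ne_zero k) (by lia)
  rw [two_mul p, Nat.add_choose_eq, Finset.Nat.sum_antidiagonal_eq_sum_range_succ_mk,
    Finset.sum_range_succ, Finset.sum_range_succ', Int.modEq_iff_dvd]
  push_cast
  simp only [Nat.succ_eq_add_one, Nat.choose_zero_right, Nat.sub_self, Nat.cast_one,
    one_mul, mul_one]
  have : (p : ℤ) ^ 2 ∣
      ∑ k ∈ Finset.range i, (p.choose (k + 1) : ℤ) * (p.choose (i - k) : ℤ) := by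
    refine Finset.dvd_sum fun k hk => ?_
    have hk := Finset.mem_range.1 hk
    rw [pow_two, show i - k = (i - 1 - k) + 1 by lia]
    exact mul_dvd_mul (hd k hk) (hd _ (by lia))
  obtain ⟨c, hc⟩ := this
  exact ⟨-c, by linear_combination -hc⟩

/-- The Sun–Tauraso congruence for sums of central binomial coefficients. -/
theorem sum_centralBinom_modEq {p : ℕ} (hp : p.Prime) (hodd : Odd p) :
    ∑ j ∈ Finset.range p, ((2 * j).choose j : ℤ) ≡ legendreSym 3 (p : ℤ) [ZMOD (p : ℤ) ^ 2] := by
  have h := sum_legendreSym_three_mul_choose p 0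
  simp only [add_zero, legendreSym_three_two_mul, hodd.neg_one_pow] at h
  rw [Finset.sum_range_succ, Nat.choose_self] at h
  rw [sum_centralBinom_eq, Finset.sum_range_succ, Nat.sub_self, Nat.choose_zero_right]
  have hk : ∀ k ∈ Finset.range p, legendreSym 3 (k : ℤ) * ((2 * p).choose (p - k) : ℤ) ≡
      2 * (legendreSym 3 (k : ℤ) * p.choose k) [ZMOD (p : ℤ) ^ 2] := by
    intro k hk
    have hk := Finset.mem_range.1 hk
    rcases Nat.eq_zero_or_pos k with rfl | hk0
    · simp [show legendreSym 3 0 = 0 by decide]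
    · have h' := choose_two_mul_prime_modEq hp (show 0 < p - k by lia) (Nat.sub_le p k)
      rw [Nat.choose_symm hk.le] at h'
      have := h'.mul_left (legendreSym 3 (k : ℤ))
      rwa [mul_left_comm] at this
  refine ((Int.ModEq.sum hk).add_right _).trans ?_
  rw [← Finset.mul_sum]
  have h0 : ∑ k ∈ Finset.range p, legendreSym 3 (k : ℤ) * (p.choose k : ℤ) = 0 := by
    push_cast at h
    linarith
  rw [h0]
  simp

/-! ### The Franel sum and the Apéry number at a prime -/

theorem isCoprime_natCast_add_one {p m : ℕ} (hp : p.Prime) (hm : m + 1 < p) :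
    IsCoprime (p : ℤ) ((m : ℤ) + 1) := by
  have := Nat.isCoprime_iff_coprime.2 (Nat.coprime_of_lt_prime (Nat.succ_ne_zero m) hm hp)
  exact_mod_cast this

theorem sq_mul_chooseProdShift_succ (n m : ℕ) : ((m : ℤ) + 1) ^ 2 * chooseProdShift n (m + 1) =
    ((n + 1) ^ 2 - (m + 1) ^ 2) * chooseProdShift n m := by
  have h1 := cast_choose_succ_right n m
  have h2 := cast_choose_succ_succ (n + 1 + m) m
  unfold chooseProdShift
  rw [← add_assoc]
  push_cast at h2
  linear_combination ((n + 1 + m + 1).choose (m + 1) : ℤ) * (m + 1) * h1 +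
    (n.choose m : ℤ) * (n - m) * h2

/-- The product `C(p-1,m) C(p+m,m)` is `∏_{0<i≤m} (p² - i²) / i²`. -/
theorem chooseProdShift_modEq {n m : ℕ} (hp : (n + 1).Prime) (hm : m < n + 1) :
    chooseProdShift n m ≡ (-1) ^ m [ZMOD ((n : ℤ) + 1) ^ 2] := by
  induction m with
  | zero => simp [chooseProdShift]
  | succ m ih =>
    have h := ih (by lia)
    have hc := (isCoprime_natCast_add_one hp hm).pow (m := 2) (n := 2)
    push_cast at hc
    have hd : ((n : ℤ) + 1) ^ 2 ∣ chooseProdShift n (m + 1) + chooseProdShift n m := by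
      refine hc.dvd_of_dvd_mul_left ⟨chooseProdShift n m, ?_⟩
      linear_combination sq_mul_chooseProdShift_succ n m
    have h' : chooseProdShift n (m + 1) ≡ -chooseProdShift n m [ZMOD ((n : ℤ) + 1) ^ 2] :=
      (Int.modEq_iff_dvd.2 (by simpa using hd)).symm
    rw [pow_succ (-1 : ℤ), mul_neg_one]
    exact h'.trans h.neg

/-- `C(n,k) C(n+k,k)` is invariant under `n ↦ -1 - n` modulo a prime. -/
theorem chooseProd_modEq {p j t i : ℕ} (hp : p.Prime) (hjt : j + t + 1 = p) (hi : i < p) :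
    chooseProd j i ≡ chooseProd t i [ZMOD p] := by
  induction i with
  | zero => simp [chooseProd_zero_right]
  | succ i ih =>
    obtain ⟨c, hc⟩ := (ih (by lia)).dvd
    have hco := (isCoprime_natCast_add_one hp hi).pow_right (n := 2)
    have hp' : (p : ℤ) = j + t + 1 := by exact_mod_cast hjt.symm
    refine Int.modEq_iff_dvd.2 (hco.dvd_of_dvd_mul_left
      ⟨(t - i) * (t + i + 1) * c + (t - j) * chooseProd j i, ?_⟩)
    rw [hp'] at hc ⊢
    linear_combination sq_mul_chooseProd_succ t i - sq_mul_chooseProd_succ j i +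
      ((t : ℤ) - i) * (t + i + 1) * hc

theorem sum_range_neg_one_pow_mul_choose_sq_mul_choose {j N : ℕ} (h : j ≤ N) :
    ∑ m ∈ Finset.range N, (-1 : ℤ) ^ m * ((m.choose j : ℤ) ^ 2 * (2 * j).choose m) =
      (2 * j).choose j * ((-1) ^ j * ∑ i ∈ Finset.range (N - j), (-1) ^ i * chooseProd j i) := by
  obtain ⟨M, rfl⟩ := Nat.exists_eq_add_of_le h
  rw [Finset.sum_range_add, Finset.sum_eq_zero, zero_add, Nat.add_sub_cancel_left,
    Finset.mul_sum, Finset.mul_sum]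
  · refine Finset.sum_congr rfl fun i _ => ?_
    have h := Nat.choose_mul (n := 2 * j) (k := j + i) (s := j) (by lia)
    rw [show 2 * j - j = j by lia, Nat.add_sub_cancel_left] at h
    have h : ((2 * j).choose (j + i) : ℤ) * (j + i).choose j = (2 * j).choose j * j.choose i := by
      exact_mod_cast h
    rw [chooseProd, ← Nat.choose_symm_add, pow_add]
    linear_combination (-1 : ℤ) ^ j * (-1) ^ i * ((j + i).choose j : ℤ) * h
  · intro m hm
    simp [Nat.choose_eq_zero_of_lt (Finset.mem_range.1 hm)]

theorem sum_neg_one_pow_mul_franel_modEq {p : ℕ} (hp : p.Prime) (hodd : Odd p) :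
    ∑ m ∈ Finset.range p, (-1) ^ m * franel m ≡
      ∑ j ∈ Finset.range p, ((2 * j).choose j : ℤ) [ZMOD (p : ℤ) ^ 2] := by
  have hf : ∀ m ∈ Finset.range p, (-1) ^ m * franel m = ∑ j ∈ Finset.range p,
      (-1 : ℤ) ^ m * ((m.choose j : ℤ) ^ 2 * (2 * j).choose m) := by
    intro m hm
    have hm := Finset.mem_range.1 hm
    rw [franel_eq_sum, ← Finset.mul_sum]
    congr 1
    refine Finset.sum_subset (Finset.range_mono hm) fun j _ hj => ?_
    simp [Nat.choose_eq_zero_of_lt (show m < j by simp at hj; lia)]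
  rw [Finset.sum_congr rfl hf, Finset.sum_comm]
  refine Int.ModEq.sum fun j hj => ?_
  have hj := Finset.mem_range.1 hj
  rw [sum_range_neg_one_pow_mul_choose_sq_mul_choose hj.le]
  rcases lt_or_ge j (p - j) with h | h
  · rw [sum_range_neg_one_pow_mul_chooseProd_right h, neg_one_pow_mul_self,
      mul_one]
  -- For `2 j ≥ p` the sum over `i` is truncated, but replacing `j` by `p - 1 - j` modulo `p`
  -- makes it complete, and the factor `C(2j,j)` supplies the second factor `p`.
  · obtain ⟨t, rfl⟩ : ∃ t, p = j + t + 1 := ⟨p - j - 1, by lia⟩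
    have hd : ((j + t + 1 : ℕ) : ℤ) ∣ ((2 * j).choose j : ℤ) := by
      rw [two_mul]
      exact_mod_cast hp.dvd_choose_add hj hj (by lia)
    have hsum : ∑ i ∈ Finset.range (j + t + 1 - j), (-1) ^ i * chooseProd j i ≡ (-1) ^ t
        [ZMOD ((j + t + 1 : ℕ) : ℤ)] := by
      rw [show j + t + 1 - j = t + 1 by lia,
        ← sum_range_neg_one_pow_mul_chooseProd_right (Nat.lt_succ_self t)]
      refine Int.ModEq.sum fun i hi => Int.ModEq.mul_left _ ?_
      exact chooseProd_modEq hp rfl (by have := Finset.mem_range.1 hi; lia)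
    have hsum := hsum.mul_left ((-1) ^ j)
    have hev : Even (j + t) := by
      have := hodd
      grind
    rw [← pow_add, hev.neg_one_pow] at hsum
    rw [Int.modEq_iff_dvd, ← mul_one_sub, pow_two]
    exact mul_dvd_mul hd hsum.dvd

theorem franelSum_modEq_legendreSym {n : ℕ} (hp : (n + 1).Prime) (hodd : Odd (n + 1)) :
    franelSum n ≡ legendreSym 3 ((n + 1 : ℕ) : ℤ) [ZMOD ((n : ℤ) + 1) ^ 2] := by
  have h1 := sum_neg_one_pow_mul_franel_modEq hp hodd
  have h2 := sum_centralBinom_modEq hp hodd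
  have h := h1.trans h2
  push_cast at h ⊢
  refine Int.ModEq.trans (Int.ModEq.sum fun m hm => ?_) h
  rw [mul_comm]
  exact (chooseProdShift_modEq hp (Finset.mem_range.1 hm)).mul_right _

theorem aperyNumber_prime_modEq {p : ℕ} (hp : p.Prime) :
    (aperyNumber p : ℤ) ≡ 5 [ZMOD p] := by
  obtain ⟨n, rfl⟩ := Nat.exists_eq_succ_of_ne_zero hp.ne_zero
  have h2 := (choose_two_mul_prime_modEq hp hp.pos le_rfl).of_dvd (dvd_pow_self _ two_ne_zero)
  rw [aperyNumber_eq_sum_range (Nat.lt_succ_self _), Finset.sum_range_succ,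
    Finset.sum_range_succ', chooseProd_zero_right, chooseProd, ← two_mul]
  simp only [Nat.succ_eq_add_one, Nat.choose_self, Nat.cast_one, one_mul, mul_one] at h2 ⊢
  have h0 : ∑ k ∈ Finset.range n, chooseProd (n + 1) (k + 1) ^ 2 ≡ 0 [ZMOD (n + 1 : ℕ)] := by
    refine Int.modEq_zero_iff_dvd.2 (Finset.dvd_sum fun k hk => dvd_pow (Dvd.dvd.mul_right ?_ _)
      two_ne_zero)
    exact_mod_cast hp.dvd_choose_self (Nat.succ_ne_zero k)
      (by have := Finset.mem_range.1 hk; lia)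
  exact (h0.add_right _).add (h2.pow 2)

/-! ### The congruence modulo `p³` -/

theorem exists_weightedAperySum_prime_eq {p : ℕ} (hp : p.Prime) (hodd : Odd p) :
    ∃ z : ℤ, 72 * weightedAperySum p =
      24 * p * legendreSym 3 (p : ℤ) - 1080 * p ^ 2 + p ^ 3 * z := by
  obtain ⟨n, rfl⟩ := Nat.exists_eq_succ_of_ne_zero hp.ne_zero
  obtain ⟨a, ha⟩ := (aperyNumber_prime_modEq hp).symm.dvd
  obtain ⟨b, hb⟩ := (franelSum_modEq_legendreSym hp hodd).symm.dvd
  have h := weightedAperySum_succ_eq n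
  have hev : Even n := by grind
  rw [hev.neg_one_pow, one_mul] at h
  refine ⟨24 * b - 216 * a - ((630 * (n + 1) + 745) * aperyNumber (n + 1) -
        (18 * (n + 1) - 7) * aperyNumber n), ?_⟩
  simp only [Nat.succ_eq_add_one] at ha hb h ⊢
  push_cast at ha hb h ⊢
  linear_combination h + 24 * ((n : ℤ) + 1) * hb - 216 * ((n : ℤ) + 1) ^ 2 * ha

theorem ratModEq_weightedAperySum {p : ℕ} (hp : p.Prime) (hodd : Odd p) :
    RatModEq (p ^ 3) (weightedAperySum p)
      ((p : ℚ) / 3 * (legendreSym 3 (p : ℤ) : ℚ) - 15 * (p : ℚ) ^ 2) := by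
  rcases eq_or_ne p 3 with rfl | h3
  · have hS : weightedAperySum 3 = -1465452 := by decide
    have hL : legendreSym 3 ((3 : ℕ) : ℤ) = 0 := by decide
    refine ⟨-54271, by norm_num, ?_⟩
    rw [hS, hL]
    norm_num
  · obtain ⟨z, hz⟩ := exists_weightedAperySum_prime_eq hp hodd
    refine ⟨(z : ℚ) / (72 : ℤ), ?_, ?_⟩
    · have hden : ((z : ℚ) / (72 : ℤ)).den ∣ 72 := by
        rw [← Rat.divInt_eq_div]
        exact_mod_cast Rat.den_dvd z 72
      have h2 : p ≠ 2 := by rintro rfl; exact absurd hodd (by decide)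
      have hc : Nat.Coprime 72 p := by
        rw [show 72 = 2 ^ 3 * 3 ^ 2 by norm_num]
        exact Nat.Coprime.mul_left
          (((Nat.coprime_primes Nat.prime_two hp).2 h2.symm).pow_left 3)
          (((Nat.coprime_primes Nat.prime_three hp).2 h3.symm).pow_left 2)
      exact (hc.coprime_dvd_left hden).pow_right 3
    · have hz' : 72 * (weightedAperySum p : ℚ) =
          24 * p * (legendreSym 3 (p : ℤ) : ℚ) - 1080 * p ^ 2 + p ^ 3 * z := by
        exact_mod_cast hz
      push_cast
      linear_combination hz' / 72

/-! ### Transfer to rational sums -/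

theorem theorem1p2 :
    (∀ n : ℕ, 0 < n →
      ∃ m : ℕ, Odd m ∧
        1 / ((n : ℚ) * ((n : ℚ) + 1)) *
          ∑ k ∈ Finset.Icc 1 n,
            (-1 : ℚ) ^ (n - k) * (9 * (k : ℚ) ^ 2 + 10 * (k : ℚ) + 3) * (k : ℚ) ^ 2 *
              (aperyNumber k : ℚ) = (m : ℚ)) ∧
    (∀ p : ℕ, p.Prime → Odd p →
      RatModEq (p ^ 3)
        (∑ k ∈ Finset.Icc 1 p,
          (-1 : ℚ) ^ k * (9 * (k : ℚ) ^ 2 + 10 * (k : ℚ) + 3) * (k : ℚ) ^ 2 *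
            (aperyNumber k : ℚ))
        ((p : ℚ) / 3 * (legendreSym 3 (p : ℤ) : ℚ) - 15 * (p : ℚ) ^ 2)) := by
  refine ⟨fun n hn => ?_, fun p hp hodd => ?_⟩
  · obtain ⟨Y, hY, hYodd⟩ := exists_odd_weightedAperySum_eq hn
    have hpos := neg_one_pow_mul_weightedAperySum_pos hn
    have hn' : (0 : ℤ) < n * (n + 1) := by positivity
    have hYpos : 0 < (-1) ^ n * Y := by
      rw [hY, mul_left_comm] at hpos
      exact pos_of_mul_pos_right hpos hn'.le
    obtain ⟨m, hm⟩ := Int.eq_ofNat_of_zero_le hYpos.le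
    refine ⟨m, ?_, ?_⟩
    · have : Odd ((-1) ^ n * Y) := Int.odd_mul.2 ⟨Odd.pow (by decide), hYodd⟩
      rw [hm] at this
      exact_mod_cast this
    · have hsum : ∑ k ∈ Finset.Icc 1 n,
          (-1 : ℚ) ^ (n - k) * (9 * (k : ℚ) ^ 2 + 10 * (k : ℚ) + 3) * (k : ℚ) ^ 2 *
            (aperyNumber k : ℚ) = (-1) ^ n * (weightedAperySum n : ℚ) := by
        rw [cast_weightedAperySum, Finset.mul_sum]
        refine Finset.sum_congr rfl fun k hk => ?_
        have hk := (Finset.mem_Icc.1 hk).2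
        have hs : (-1 : ℚ) ^ (n - k) = (-1) ^ n * (-1) ^ k := by
          obtain ⟨t, rfl⟩ := Nat.exists_eq_add_of_le hk
          rw [Nat.add_sub_cancel_left, pow_add, mul_right_comm, ← mul_pow]
          simp
        rw [hs]
        ring
      have hmq : (m : ℚ) = (-1) ^ n * (Y : ℚ) := by exact_mod_cast hm.symm
      have hn0 : (n : ℚ) ≠ 0 := by exact_mod_cast hn.ne'
      have hn1 : (n : ℚ) + 1 ≠ 0 := by positivity
      rw [hsum, hY, hmq]
      push_cast
      field_simp
  · rw [← cast_weightedAperySum]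
    exact ratModEq_weightedAperySum hp hodd
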